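/- Let $(\Omega,\mathcal G,\mathbb P)$ be a probability space with a filtration $(\mathcal F_t)_{t\ge0}$ satisfying the usual conditions, and let $\tau>0$. For a stopping time $S$, $\mathbb E_S$ denotes the conditional expectation given $\mathcal F_S$. Let $(V_t)_{t\in[0,\tau]}$ be a real-valued adapted process whose paths are right-continuous with left limits; put $V_{s-}=\lim_{u\uparrow s}V_u$ for $s>0$ and $V_{0-}=V_0$. For $0\le s\le t\le\tau$ define \[ \rho_{s,t}(V)=\sup_{s\le S\le T\le t}\big\|\mathbb E_S|V_T-V_{S-}|\big\|_\infty,\qquad \kappa_{s,t}(V)=\lim_{h\downarrow0}\ \sup_{s\le u\le v\le t,\ v-u\le h}\rho_{u,v}(V), \] where $S,T$ range over stopping times. The process $V$ is called BMO if $\rho_{0,\tau}(V)<\infty$, and VMO if it is BMO and $\kappa_{0,\tau}(V)=0$. For $p\in[1,\infty)$, a VMO process $V$ is said to belong to $\mathrm{VMO}^{p\text{-var}}$ if $[V]_{p\text{-var};[0,\tau]}<\infty$, where \[ [V]_{p\text{-var};[s,t]}=\Big(\sup_{\pi}\sum_{[u,v]\in\pi}\rho_{u,v}(V)^p\Big)^{1/p}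 \] with the supremum over all finite partitions $\pi$ of $[s,t]$; in that case put $w_{s,t}(V)=[V]_{p\text{-var};[s,t]}^p$. Let $V$ be VMO. Then for every $r\in[0,\tau]$ and every $\lambda>0$, \[ \Big\|\mathbb E_r\, e^{\lambda\sup_{t\in[r,\tau]}|V_t-V_r|}\Big\|_\infty<\infty , \] and in particular $\mathbb E_r\, e^{\lambda\sup_{t\in[r,\tau]}|V_t-V_r|}<\infty$ almost surely. If moreover $V$ belongs to $\mathrm{VMO}^{p\text{-var}}$ for some $p\in[1,\infty)$, then for every $\lambda>0$ and every $r\in[0,\tau]$, almost surely, \[ \mathbb E_r\, e^{\lambda\sup_{t\in[r,\tau]}|V_t-V_r|}\le 2^{\,1+(22\lambda)^p\,w_{0,\tau}(V)} . \] -/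

import Mathlib

open MeasureTheory Filter Topology
open scoped NNReal ENNReal

/-- The usual conditions: the filtration is right-continuous, and `𝓕 0` contains every `P`-null
set (`P` is applied to arbitrary sets, as an outer measure, so the ambient σ-algebra is complete
as well). -/
structure UsualConditions {Ω : Type*} {mΩ : MeasurableSpace Ω} (P : Measure Ω)
    (𝓕 : Filtration ℝ≥0 mΩ) : Prop where
  rightContinuous : 𝓕.IsRightContinuous
  complete : ∀ N : Set Ω, P N = 0 → MeasurableSet[𝓕 0] N

/-- `(V_t)_{t ∈ [0,τ]}` is adapted, right-continuous on `[0,τ)` and has left limits on `(0,τ]`.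
The values `V t` for `t > τ` play no role. -/
structure IsAdaptedRCLL {Ω : Type*} {mΩ : MeasurableSpace Ω} (𝓕 : Filtration ℝ≥0 mΩ)
    (τ : ℝ≥0) (V : ℝ≥0 → Ω → ℝ) : Prop where
  adapted : ∀ t ≤ τ, Measurable[𝓕 t] (V t)
  rightContinuous : ∀ ω, ∀ t < τ, Tendsto (fun u => V u ω) (𝓝[>] t) (𝓝 (V t ω))
  leftLimit : ∀ ω, ∀ t, 0 < t → t ≤ τ → ∃ l : ℝ, Tendsto (fun u => V u ω) (𝓝[<] t) (𝓝 l)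

/-- The left limit `V_{s-}`, with `V_{0-} = V_0`. -/
noncomputable def leftVal {Ω : Type*} (V : ℝ≥0 → Ω → ℝ) (s : ℝ≥0) (ω : Ω) : ℝ :=
  Function.leftLim (fun u => V u ω) s

theorem leftVal_zero {Ω : Type*} (V : ℝ≥0 → Ω → ℝ) (ω : Ω) : leftVal V 0 ω = V 0 ω := by
  refine leftLim_eq_of_eq_bot _ ?_
  have h : Set.Iio (0 : ℝ≥0) = ∅ := by ext x; simp
  rw [h, nhdsWithin_empty]

/-- The modulus of mean oscillation
`ρ_{s,t}(V) = sup_{s ≤ S ≤ T ≤ t} ‖E_S |V_T - V_{S-}|‖_∞`, the supremum being over all stopping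
times `S, T` with `s ≤ S ≤ T ≤ t`. It is `[0,∞]`-valued; `E_S` is the conditional expectation of
nonnegative random variables given `𝓕_S`, and `‖·‖_∞` of a nonnegative variable is its essential
supremum. -/
noncomputable def modulusMO {Ω : Type*} {mΩ : MeasurableSpace Ω} (P : Measure Ω)
    (𝓕 : Filtration ℝ≥0 mΩ) (V : ℝ≥0 → Ω → ℝ) (s t : ℝ≥0) : ℝ≥0∞ :=
  ⨆ (S : Ω → ℝ≥0) (T : Ω → ℝ≥0)
    (hS : IsStoppingTime 𝓕 (fun ω => (S ω : WithTop ℝ≥0)))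
    (_ : IsStoppingTime 𝓕 (fun ω => (T ω : WithTop ℝ≥0)))
    (_ : ∀ ω, s ≤ S ω ∧ S ω ≤ T ω ∧ T ω ≤ t),
    essSup (condLExp hS.measurableSpace P
      (fun ω => ENNReal.ofReal |V (T ω) ω - leftVal V (S ω) ω|)) P

/-- `sup_{s ≤ u ≤ v ≤ t, v - u ≤ h} ρ_{u,v}(V)`. -/
noncomputable def supModulusMO {Ω : Type*} {mΩ : MeasurableSpace Ω} (P : Measure Ω)
    (𝓕 : Filtration ℝ≥0 mΩ) (V : ℝ≥0 → Ω → ℝ) (s t h : ℝ≥0) : ℝ≥0∞ :=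
  ⨆ (u : ℝ≥0) (v : ℝ≥0) (_ : s ≤ u ∧ u ≤ v ∧ v ≤ t ∧ v ≤ u + h), modulusMO P 𝓕 V u v

/-- `κ_{s,t}(V) = lim_{h ↓ 0} sup_{s ≤ u ≤ v ≤ t, v - u ≤ h} ρ_{u,v}(V)`; the limit is the infimum
over `h > 0` because the supremum is monotone in `h` (see `tendsto_kappaMO`). -/
noncomputable def kappaMO {Ω : Type*} {mΩ : MeasurableSpace Ω} (P : Measure Ω)
    (𝓕 : Filtration ℝ≥0 mΩ) (V : ℝ≥0 → Ω → ℝ) (s t : ℝ≥0) : ℝ≥0∞ :=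
  ⨅ (h : ℝ≥0) (_ : 0 < h), supModulusMO P 𝓕 V s t h

theorem supModulusMO_mono {Ω : Type*} {mΩ : MeasurableSpace Ω} (P : Measure Ω)
    (𝓕 : Filtration ℝ≥0 mΩ) (V : ℝ≥0 → Ω → ℝ) (s t : ℝ≥0) :
    Monotone (supModulusMO P 𝓕 V s t) := by
  intro h h' hh
  refine iSup_le fun u => iSup_le fun v => iSup_le fun huv => ?_
  exact le_iSup_of_le u (le_iSup_of_le v (le_iSup_of_le
    ⟨huv.1, huv.2.1, huv.2.2.1, huv.2.2.2.trans (by gcongr)⟩ le_rfl))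

theorem tendsto_kappaMO {Ω : Type*} {mΩ : MeasurableSpace Ω} (P : Measure Ω)
    (𝓕 : Filtration ℝ≥0 mΩ) (V : ℝ≥0 → Ω → ℝ) (s t : ℝ≥0) :
    Tendsto (supModulusMO P 𝓕 V s t) (𝓝[>] 0) (𝓝 (kappaMO P 𝓕 V s t)) := by
  have h := (supModulusMO_mono P 𝓕 V s t).tendsto_nhdsGT 0
  rwa [sInf_image] at h

/-- `V` is a process of bounded mean oscillation on `[0,τ]`. -/
structure IsBMO {Ω : Type*} {mΩ : MeasurableSpace Ω} (P : Measure Ω)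
    (𝓕 : Filtration ℝ≥0 mΩ) (τ : ℝ≥0) (V : ℝ≥0 → Ω → ℝ) : Prop where
  rcll : IsAdaptedRCLL 𝓕 τ V
  finite : modulusMO P 𝓕 V 0 τ < ∞

/-- `V` is a process of vanishing mean oscillation on `[0,τ]`. -/
structure IsVMO {Ω : Type*} {mΩ : MeasurableSpace Ω} (P : Measure Ω)
    (𝓕 : Filtration ℝ≥0 mΩ) (τ : ℝ≥0) (V : ℝ≥0 → Ω → ℝ) : Prop where
  bmo : IsBMO P 𝓕 τ V
  vanishing : kappaMO P 𝓕 V 0 τ = 0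

/-- `[V]_{VMO^{p-var};[s,t]} = (sup_π ∑_{[u,v] ∈ π} ρ_{u,v}(V)^p)^{1/p}`, the supremum being over
all partitions `s = x 0 < x 1 < ⋯ < x n = t` of `[s,t]`. -/
noncomputable def pVarMO {Ω : Type*} {mΩ : MeasurableSpace Ω} (P : Measure Ω)
    (𝓕 : Filtration ℝ≥0 mΩ) (V : ℝ≥0 → Ω → ℝ) (p : ℝ) (s t : ℝ≥0) : ℝ≥0∞ :=
  (⨆ (n : ℕ) (x : ℕ → ℝ≥0)
    (_ : StrictMonoOn x (Set.Iic n) ∧ x 0 = s ∧ x n = t),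
    ∑ i ∈ Finset.range n, modulusMO P 𝓕 V (x i) (x (i + 1)) ^ p) ^ (1 / p)

/-- `V` belongs to `VMO^{p-var}` on `[0,τ]`. -/
structure IsVMOpVar {Ω : Type*} {mΩ : MeasurableSpace Ω} (P : Measure Ω)
    (𝓕 : Filtration ℝ≥0 mΩ) (τ : ℝ≥0) (V : ℝ≥0 → Ω → ℝ) (p : ℝ) : Prop where
  vmo : IsVMO P 𝓕 τ V
  finite : pVarMO P 𝓕 V p 0 τ < ∞

/-- `w_{s,t}(V) = [V]_{VMO^{p-var};[s,t]}^p`. -/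
noncomputable def controlMO {Ω : Type*} {mΩ : MeasurableSpace Ω} (P : Measure Ω)
    (𝓕 : Filtration ℝ≥0 mΩ) (V : ℝ≥0 → Ω → ℝ) (p : ℝ) (s t : ℝ≥0) : ℝ≥0∞ :=
  pVarMO P 𝓕 V p s t ^ p

/-- `sup_{t ∈ [r,τ]} |V_t - V_r|`; a path with one-sided limits is bounded on `[r,τ]`
(see `IsAdaptedRCLL.bddAbove`), so this is a true supremum. -/
noncomputable def supIncrement {Ω : Type*} (V : ℝ≥0 → Ω → ℝ) (r τ : ℝ≥0) (ω : Ω) : ℝ :=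
  ⨆ t : Set.Icc r τ, |V t ω - V r ω|

theorem IsAdaptedRCLL.bddAbove {Ω : Type*} {mΩ : MeasurableSpace Ω} {𝓕 : Filtration ℝ≥0 mΩ}
    {τ : ℝ≥0} {V : ℝ≥0 → Ω → ℝ} (hV : IsAdaptedRCLL 𝓕 τ V) (r : ℝ≥0) (ω : Ω) :
    BddAbove (Set.range fun t : Set.Icc r τ => |V t ω - V r ω|) := by
  have key : ∃ C : ℝ, ∀ t ∈ Set.Icc r τ, t ≤ τ → |V t ω| ≤ C := by
    refine isCompact_Icc.induction_on
      (p := fun s : Set ℝ≥0 => ∃ C : ℝ, ∀ t ∈ s, t ≤ τ → |V t ω| ≤ C) ⟨0, by simp⟩ ?_ ?_ ?_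
    · rintro s s' hs ⟨C, hC⟩
      exact ⟨C, fun t ht => hC t (hs ht)⟩
    · rintro s s' ⟨C, hC⟩ ⟨C', hC'⟩
      refine ⟨max C C', fun t ht h => ?_⟩
      rcases ht with ht | ht
      · exact (hC t ht h).trans (le_max_left _ _)
      · exact (hC' t ht h).trans (le_max_right _ _)
    · intro x hx
      have hL : ∃ C : ℝ, ∀ᶠ t in 𝓝[<] x, t ≤ τ → |V t ω| ≤ C := by
        rcases eq_or_lt_of_le (zero_le : (0 : ℝ≥0) ≤ x) with h0 | h0
        · refine ⟨0, ?_⟩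
          have h : Set.Iio x = ∅ := by rw [← h0]; ext y; simp
          rw [h, nhdsWithin_empty]
          exact eventually_bot
        · obtain ⟨l, hl⟩ := hV.leftLimit ω x h0 hx.2
          refine ⟨|l| + 1, ?_⟩
          filter_upwards [hl.abs.eventually_lt_const (lt_add_one |l|)] with t ht _ using ht.le
      have hR : ∃ C : ℝ, ∀ᶠ t in 𝓝[>] x, t ≤ τ → |V t ω| ≤ C := by
        rcases lt_or_ge x τ with h0 | h0
        · refine ⟨|V x ω| + 1, ?_⟩
          filter_upwards [(hV.rightContinuous ω x h0).abs.eventually_lt_const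
            (lt_add_one |V x ω|)] with t ht _ using ht.le
        · refine ⟨0, ?_⟩
          filter_upwards [self_mem_nhdsWithin] with t ht h
          exact absurd (h.trans h0) (not_le.2 ht)
      obtain ⟨C, hC⟩ := hL
      obtain ⟨C', hC'⟩ := hR
      have hN : ∀ᶠ t in 𝓝 x, t ≤ τ → |V t ω| ≤ max (max C C') |V x ω| := by
        rw [← nhdsNE_sup_pure, ← nhdsLT_sup_nhdsGT, eventually_sup, eventually_sup]
        refine ⟨⟨?_, ?_⟩, ?_⟩
        · filter_upwards [hC] with t ht h
          exact (ht h).trans ((le_max_left _ _).trans (le_max_left _ _))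
        · filter_upwards [hC'] with t ht h
          exact (ht h).trans ((le_max_right _ _).trans (le_max_left _ _))
        · rw [eventually_pure]
          exact fun _ => le_max_right _ _
      exact ⟨_, mem_nhdsWithin_of_mem_nhds hN, _, fun t ht => ht⟩
  obtain ⟨C, hC⟩ := key
  refine ⟨C + |V r ω|, ?_⟩
  rintro _ ⟨t, rfl⟩
  exact (abs_sub _ _).trans (add_le_add_left (hC t t.2 t.2.2) _)

/-- The conditional exponential moment `E_r exp(λ sup_{t ∈ [r,τ]} |V_t - V_r|)`, as a
`[0,∞]`-valued random variable. -/
noncomputable def condExpMoment {Ω : Type*} {mΩ : MeasurableSpace Ω} (P : Measure Ω)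
    (𝓕 : Filtration ℝ≥0 mΩ) (V : ℝ≥0 → Ω → ℝ) (τ r : ℝ≥0) (lam : ℝ) : Ω → ℝ≥0∞ :=
  condLExp (𝓕 r) P (fun ω => ENNReal.ofReal (Real.exp (lam * supIncrement V r τ ω)))

/-! The argument is a John–Nirenberg estimate on short intervals, followed by a greedy partition.
Put `c = 1/(22λ)`. If `ρ_{u,v} ≤ c`, compare the passage times `S ≤ T` of `|V - V_u|` above `b` and
`b + a`: when `b + a` is exceeded, `|V_T - V_{S-}| ≥ a`, because the left limit at `S` has not yet
overshot `b`. With `a = 2c` each further level halves the conditional probability, so the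
exponential moment on `[u,v]` is at most `5/4` (`IsAdaptedRCLL.expMomentLE`). Such bounds multiply
over adjacent intervals (`ExpMomentLE.trans`). By VMO, intervals of length at most some `h` satisfy
`ρ ≤ c`. Advance by steps `h` and close a cell once its `ρ` exceeds `c`: it splits into two
intervals with `ρ ≤ c` and costs `(5/4)² ≤ 2`. The unclosed last cell costs at most `2`. With `N`
closed cells the total is `2^(N+1)`, while `N c^p ≤ w_{0,τ}` (`IsVMO.exists_expMomentLE`). -/

/-! ### The modulus of mean oscillation and left limits -/

section Modulus

variable {Ω : Type*} {mΩ : MeasurableSpace Ω} {P : Measure Ω} {𝓕 : Filtration ℝ≥0 mΩ}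
  {V : ℝ≥0 → Ω → ℝ} {τ : ℝ≥0}

theorem IsAdaptedRCLL.mono (hV : IsAdaptedRCLL 𝓕 τ V) {v : ℝ≥0} (hv : v ≤ τ) :
    IsAdaptedRCLL 𝓕 v V where
  adapted t ht := hV.adapted t (ht.trans hv)
  rightContinuous ω t ht := hV.rightContinuous ω t (ht.trans_le hv)
  leftLimit ω t h0 ht := hV.leftLimit ω t h0 (ht.trans hv)

/-- The integrated form of the modulus; the estimates below use it in place of conditional
expectations. -/
theorem setLIntegral_le_modulusMO [IsProbabilityMeasure P] {s t : ℝ≥0} {S T : Ω → ℝ≥0}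
    (hS : IsStoppingTime 𝓕 (fun ω => (S ω : WithTop ℝ≥0)))
    (hT : IsStoppingTime 𝓕 (fun ω => (T ω : WithTop ℝ≥0)))
    (hST : ∀ ω, s ≤ S ω ∧ S ω ≤ T ω ∧ T ω ≤ t)
    {B : Set Ω} (hB : MeasurableSet[hS.measurableSpace] B) :
    ∫⁻ ω in B, ENNReal.ofReal |V (T ω) ω - leftVal V (S ω) ω| ∂P ≤
      modulusMO P 𝓕 V s t * P B := by
  rw [← setLIntegral_condLExp hS.measurableSpace_le P _ hB, ← setLIntegral_const]
  refine lintegral_mono_ae (ae_restrict_of_ae ?_)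
  filter_upwards [ENNReal.ae_le_essSup (μ := P) (condLExp hS.measurableSpace P
    (fun ω => ENNReal.ofReal |V (T ω) ω - leftVal V (S ω) ω|))] with ω hω
  refine hω.trans ?_
  exact le_iSup_of_le S (le_iSup_of_le T (le_iSup_of_le hS (le_iSup_of_le hT
    (le_iSup_of_le hST le_rfl))))

theorem IsVMO.exists_modulusMO_le (hV : IsVMO P 𝓕 τ V) {c : ℝ≥0∞} (hc : 0 < c) :
    ∃ h : ℝ≥0, 0 < h ∧ ∀ u v, u ≤ v → v ≤ τ → v ≤ u + h → modulusMO P 𝓕 V u v ≤ c := by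
  have h0 := hV.vanishing
  rw [← h0, kappaMO] at hc
  simp only [iInf_lt_iff] at hc
  obtain ⟨h, hh, hlt⟩ := hc
  refine ⟨h, hh, fun u v huv hv hvh => le_trans ?_ hlt.le⟩
  exact le_iSup_of_le u (le_iSup_of_le v (le_iSup_of_le ⟨zero_le, huv, hv, hvh⟩ le_rfl))

theorem IsVMO.modulusMO_self (hV : IsVMO P 𝓕 τ V) {u : ℝ≥0} (hu : u ≤ τ) :
    modulusMO P 𝓕 V u u = 0 := by
  refine le_antisymm (le_of_forall_gt fun c hc => ?_) zero_le
  obtain ⟨d, hd, hdc⟩ := exists_between hc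
  obtain ⟨h, -, H⟩ := hV.exists_modulusMO_le hd
  exact (H u u le_rfl hu (by simp)).trans_lt hdc

theorem IsAdaptedRCLL.tendsto_leftVal (hV : IsAdaptedRCLL 𝓕 τ V) {t : ℝ≥0} (ht : 0 < t)
    (htτ : t ≤ τ) (ω : Ω) :
    Tendsto (fun u => V u ω) (𝓝[<] t) (𝓝 (leftVal V t ω)) :=
  tendsto_leftLim_of_tendsto (hV.leftLimit ω t ht htτ)

theorem IsAdaptedRCLL.measurable_leftVal (hV : IsAdaptedRCLL 𝓕 τ V) {t : ℝ≥0} (ht : t ≤ τ) :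
    Measurable (leftVal V t) := by
  rcases eq_or_lt_of_le (zero_le : 0 ≤ t) with rfl | h0
  · have : leftVal V 0 = V 0 := funext (leftVal_zero V)
    rw [this]
    exact (hV.adapted 0 ht).mono (𝓕.le 0) le_rfl
  · obtain ⟨x, -, hx, hlim⟩ := exists_seq_strictMono_tendsto' h0
    refine measurable_of_tendsto_metrizable (f := fun n => V (x n))
      (fun n => (hV.adapted _ ((hx n).2.le.trans ht)).mono (𝓕.le _) le_rfl) ?_
    rw [tendsto_pi_nhds]
    intro ω
    refine (hV.tendsto_leftVal h0 ht ω).comp (tendsto_nhdsWithin_iff.2 ⟨hlim, ?_⟩)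
    exact Eventually.of_forall fun n => (hx n).2

/-- A VMO process has no jump at a fixed time: take `S = T = u` in `ρ_{u,u} = 0`. Hence increments
over `[u,v]` may be measured from `V_u` although `ρ` involves `V_{u-}`. -/
theorem IsVMO.leftVal_ae_eq [IsProbabilityMeasure P] (hV : IsVMO P 𝓕 τ V) {u : ℝ≥0}
    (hu : u ≤ τ) : ∀ᵐ ω ∂P, leftVal V u ω = V u ω := by
  have hc : IsStoppingTime 𝓕 (fun _ : Ω => (u : WithTop ℝ≥0)) := isStoppingTime_const 𝓕 u
  have h := setLIntegral_le_modulusMO (P := P) (V := V) (s := u) (t := u)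
    (S := fun _ => u) (T := fun _ => u) hc hc (fun _ => ⟨le_rfl, le_rfl, le_rfl⟩)
    (@MeasurableSet.univ _ hc.measurableSpace)
  rw [hV.modulusMO_self hu, zero_mul, nonpos_iff_eq_zero, Measure.restrict_univ,
    lintegral_eq_zero_iff] at h
  · filter_upwards [h] with ω hω
    simp only [Pi.zero_apply, ENNReal.ofReal_eq_zero] at hω
    have := abs_nonpos_iff.1 hω
    linarith
  · have h1 := (hV.bmo.rcll.adapted u hu).mono (𝓕.le u) le_rfl
    have h2 := hV.bmo.rcll.measurable_leftVal hu
    exact (((h1.sub h2).abs).ennreal_ofReal)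

end Modulus

/-! ### Passage times and the running supremum -/

theorem measurableSet_lt_abs_sub {Ω : Type*} {m : MeasurableSpace Ω} {f g : Ω → ℝ}
    (hf : Measurable f) (hg : Measurable g) (b : ℝ) : MeasurableSet {ω | b < |f ω - g ω|} :=
  measurableSet_lt measurable_const (hf.sub hg).abs

section Exceed

variable {Ω : Type*} {mΩ : MeasurableSpace Ω} {P : Measure Ω} {𝓕 : Filtration ℝ≥0 mΩ}
  {V : ℝ≥0 → Ω → ℝ} {u v : ℝ≥0} {b : ℝ}

/-- The first time in `[u,v]` at which `|V_t - V_u|` exceeds `b`, or `v` if there is none. -/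
noncomputable def exceedTime (V : ℝ≥0 → Ω → ℝ) (u v : ℝ≥0) (b : ℝ) (ω : Ω) : ℝ≥0 :=
  sInf ({t | t ∈ Set.Icc u v ∧ b < |V t ω - V u ω|} ∪ {v})

theorem exceedTime_le (V : ℝ≥0 → Ω → ℝ) (u v : ℝ≥0) (b : ℝ) (ω : Ω) :
    exceedTime V u v b ω ≤ v :=
  csInf_le (OrderBot.bddBelow _) (Or.inr rfl)

theorem le_exceedTime (V : ℝ≥0 → Ω → ℝ) (huv : u ≤ v) (b : ℝ) (ω : Ω) :
    u ≤ exceedTime V u v b ω := by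
  refine le_csInf ⟨v, Or.inr rfl⟩ ?_
  rintro t (ht | rfl)
  exacts [ht.1.1, huv]

theorem exceedTime_mono (V : ℝ≥0 → Ω → ℝ) (u v : ℝ≥0) {b b' : ℝ} (hb : b ≤ b') (ω : Ω) :
    exceedTime V u v b ω ≤ exceedTime V u v b' ω := by
  refine csInf_le_csInf (OrderBot.bddBelow _) ⟨v, Or.inr rfl⟩ ?_
  exact Set.union_subset_union_left _ fun t ht => ⟨ht.1, hb.trans_lt ht.2⟩

theorem exceedTime_lt_iff {t : ℝ≥0} (htv : t ≤ v) {ω : Ω} :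
    exceedTime V u v b ω < t ↔ ∃ x, u ≤ x ∧ x < t ∧ b < |V x ω - V u ω| := by
  rw [exceedTime, csInf_lt_iff (OrderBot.bddBelow _) ⟨v, Or.inr rfl⟩]
  constructor
  · rintro ⟨x, hx | rfl, hxt⟩
    · exact ⟨x, hx.1.1, hxt, hx.2⟩
    · exact absurd hxt (not_lt.2 htv)
  · rintro ⟨x, hux, hxt, hb⟩
    exact ⟨x, Or.inl ⟨⟨hux, hxt.le.trans htv⟩, hb⟩, hxt⟩

theorem lt_supIncrement_iff (hV : IsAdaptedRCLL 𝓕 v V) (huv : u ≤ v) {ω : Ω} :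
    b < supIncrement V u v ω ↔ ∃ x, u ≤ x ∧ x ≤ v ∧ b < |V x ω - V u ω| := by
  have : Nonempty (Set.Icc u v) := ⟨⟨u, le_rfl, huv⟩⟩
  rw [supIncrement, lt_ciSup_iff (hV.bddAbove u ω)]
  constructor
  · rintro ⟨⟨x, h1, h2⟩, h⟩
    exact ⟨x, h1, h2, h⟩
  · rintro ⟨x, h1, h2, h⟩
    exact ⟨⟨x, h1, h2⟩, h⟩

/-- The value `v` of the passage time is ambiguous: the level may be exceeded only at `v`, or never.
The second alternative recovers the former case. -/
theorem lt_supIncrement_iff_exceedTime_lt (hV : IsAdaptedRCLL 𝓕 v V) (huv : u ≤ v) {ω : Ω} :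
    b < supIncrement V u v ω ↔ exceedTime V u v b ω < v ∨ b < |V v ω - V u ω| := by
  rw [lt_supIncrement_iff hV huv, exceedTime_lt_iff le_rfl]
  constructor
  · rintro ⟨x, h1, h2, h⟩
    rcases h2.lt_or_eq with h2 | rfl
    · exact Or.inl ⟨x, h1, h2, h⟩
    · exact Or.inr h
  · rintro (⟨x, h1, h2, h⟩ | h)
    · exact ⟨x, h1, h2.le, h⟩
    · exact ⟨v, huv, le_rfl, h⟩

theorem supIncrement_nonneg (V : ℝ≥0 → Ω → ℝ) (u v : ℝ≥0) (ω : Ω) :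
    0 ≤ supIncrement V u v ω :=
  Real.iSup_nonneg fun _ => abs_nonneg _

theorem IsAdaptedRCLL.measurableSet_exceedTime_lt (hV : IsAdaptedRCLL 𝓕 v V) (b : ℝ)
    {t : ℝ≥0} (htv : t ≤ v) : MeasurableSet[𝓕 t] {ω | exceedTime V u v b ω < t} := by
  obtain ⟨D, hDc, hDd⟩ := TopologicalSpace.exists_countable_dense ℝ≥0
  have : {ω | exceedTime V u v b ω < t} =
      ⋃ x ∈ {x ∈ D | u ≤ x ∧ x < t}, {ω | b < |V x ω - V u ω|} := by
    ext ω
    simp only [Set.mem_ofPred_eq, exceedTime_lt_iff htv, Set.mem_iUnion, exists_prop]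
    constructor
    · rintro ⟨x, hux, hxt, hb⟩
      -- Right continuity moves the witness `x` to a nearby point of the countable dense set, still
      -- below `t`.
      have h1 := (((hV.rightContinuous ω x (hxt.trans_le htv)).sub_const (V u ω)).abs).eventually
        (lt_mem_nhds hb)
      obtain ⟨y, hy, hy'⟩ := (mem_nhdsGT_iff_exists_Ioo_subset' hxt).1 h1
      obtain ⟨z, hz, hz'⟩ := hDd.exists_between (lt_min hy hxt)
      exact ⟨z, ⟨hz, hux.trans hz'.1.le, hz'.2.trans_le (min_le_right _ _)⟩,
        hy' ⟨hz'.1, hz'.2.trans_le (min_le_left _ _)⟩⟩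
    · rintro ⟨x, ⟨-, h1, h2⟩, h⟩
      exact ⟨x, h1, h2, h⟩
  rw [this]
  refine MeasurableSet.biUnion (hDc.mono fun _ h => h.1) fun x hx => ?_
  have h1 : Measurable[𝓕 t] (V x) :=
    (hV.adapted x (hx.2.2.le.trans htv)).mono (𝓕.mono hx.2.2.le) le_rfl
  have h2 : Measurable[𝓕 t] (V u) :=
    (hV.adapted u (hx.2.1.trans (hx.2.2.le.trans htv))).mono
      (𝓕.mono (hx.2.1.trans hx.2.2.le)) le_rfl
  exact measurableSet_lt_abs_sub h1 h2 b

theorem IsAdaptedRCLL.isStoppingTime_exceedTime [𝓕.IsRightContinuous]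
    (hV : IsAdaptedRCLL 𝓕 v V) (b : ℝ) :
    IsStoppingTime 𝓕 (fun ω => (exceedTime V u v b ω : WithTop ℝ≥0)) := by
  refine isStoppingTime_of_measurableSet_lt_of_isRightContinuous fun t => ?_
  simp only [WithTop.coe_lt_coe]
  rcases le_or_gt t v with h | h
  · exact hV.measurableSet_exceedTime_lt b h
  · have : {ω | exceedTime V u v b ω < t} = Set.univ :=
      Set.eq_univ_of_forall fun ω => (exceedTime_le V u v b ω).trans_lt h
    rw [this]
    exact MeasurableSet.univ

theorem IsAdaptedRCLL.measurableSet_lt_supIncrement (hV : IsAdaptedRCLL 𝓕 v V) (huv : u ≤ v)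
    (b : ℝ) : MeasurableSet[𝓕 v] {ω | b < supIncrement V u v ω} := by
  have : {ω | b < supIncrement V u v ω} =
      {ω | exceedTime V u v b ω < v} ∪ {ω | b < |V v ω - V u ω|} := by
    ext ω
    exact lt_supIncrement_iff_exceedTime_lt hV huv
  rw [this]
  refine (hV.measurableSet_exceedTime_lt b le_rfl).union ?_
  exact measurableSet_lt_abs_sub (hV.adapted v le_rfl)
    ((hV.adapted u huv).mono (𝓕.mono huv) le_rfl) b

theorem IsAdaptedRCLL.measurable_supIncrement (hV : IsAdaptedRCLL 𝓕 v V) (huv : u ≤ v) :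
    Measurable[𝓕 v] (supIncrement V u v) :=
  @measurable_of_Ioi _ _ _ _ _ (𝓕 v) _ _ _ _ fun b => hV.measurableSet_lt_supIncrement huv b

/-- On `{S ≤ t}` with `t < v` the level has been exceeded, so only `t ≥ v` involves the event
itself. This makes it an admissible conditioning set at time `S`. -/
theorem IsAdaptedRCLL.measurableSet_lt_supIncrement_inter [𝓕.IsRightContinuous]
    (hV : IsAdaptedRCLL 𝓕 v V) (huv : u ≤ v) (b : ℝ) {A : Set Ω} (hA : MeasurableSet[𝓕 u] A) :
    MeasurableSet[(hV.isStoppingTime_exceedTime (u := u) b).measurableSpace]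
      (A ∩ {ω | b < supIncrement V u v ω}) := by
  have hA' : MeasurableSet[(hV.isStoppingTime_exceedTime (u := u) b).measurableSpace] A :=
    IsStoppingTime.le_measurableSpace_of_const_le _
      (fun ω => WithTop.coe_le_coe.2 (le_exceedTime V huv b ω)) _ hA
  refine hA'.inter ?_
  rw [IsStoppingTime.measurableSet]
  refine ⟨le_iSup 𝓕 v _ (hV.measurableSet_lt_supIncrement huv b), fun t => ?_⟩
  simp only [WithTop.coe_le_coe]
  rcases lt_or_ge t v with h | h
  · have : {ω | b < supIncrement V u v ω} ∩ {ω | exceedTime V u v b ω ≤ t} =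
        {ω | exceedTime V u v b ω ≤ t} := by
      refine Set.inter_eq_right.2 fun ω hω => ?_
      exact (lt_supIncrement_iff_exceedTime_lt hV huv).2 (Or.inl (lt_of_le_of_lt hω h))
    rw [this]
    have := hV.isStoppingTime_exceedTime (u := u) b t
    simpa only [WithTop.coe_le_coe] using this
  · have : {ω | b < supIncrement V u v ω} ∩ {ω | exceedTime V u v b ω ≤ t} =
        {ω | b < supIncrement V u v ω} :=
      Set.inter_eq_left.2 fun ω _ => (exceedTime_le V u v b ω).trans h
    rw [this]
    exact 𝓕.mono h _ (hV.measurableSet_lt_supIncrement huv b)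

theorem IsAdaptedRCLL.le_abs_exceedTime (hV : IsAdaptedRCLL 𝓕 v V) (huv : u ≤ v) {ω : Ω}
    (h : b < supIncrement V u v ω) : b ≤ |V (exceedTime V u v b ω) ω - V u ω| := by
  by_contra! hlt
  rcases (exceedTime_le V u v b ω).lt_or_eq with hT | hT
  · have h1 := (((hV.rightContinuous ω _ hT).sub_const (V u ω)).abs).eventually
      (gt_mem_nhds hlt)
    obtain ⟨y, hy, hy'⟩ := (mem_nhdsGT_iff_exists_Ioo_subset' hT).1 h1
    have h2 : exceedTime V u v b ω < min y v := lt_min hy hT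
    obtain ⟨x, hux, hxy, hx⟩ := (exceedTime_lt_iff (min_le_right _ _)).1 h2
    have hxv := hxy.trans_le (min_le_right y v)
    have h3 : exceedTime V u v b ω ≤ x :=
      csInf_le (OrderBot.bddBelow _) (Or.inl ⟨⟨hux, hxv.le⟩, hx⟩)
    rcases h3.lt_or_eq with h3 | h3
    · exact lt_asymm hx (hy' ⟨h3, hxy.trans_le (min_le_left _ _)⟩)
    · rw [h3] at hlt
      exact lt_asymm hx hlt
  · rcases (lt_supIncrement_iff_exceedTime_lt hV huv).1 h with h | h
    · exact h.ne hT
    · rw [hT] at hlt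
      exact lt_asymm h hlt

/-- Before the passage time the path stays within `b` of `V_u`, and so does its left limit. The
hypothesis at `u` covers immediate passage. -/
theorem IsAdaptedRCLL.abs_leftVal_exceedTime_le (hV : IsAdaptedRCLL 𝓕 v V) (huv : u ≤ v)
    (hb : 0 ≤ b) {ω : Ω} (hu : leftVal V u ω = V u ω) :
    |leftVal V (exceedTime V u v b ω) ω - V u ω| ≤ b := by
  rcases (le_exceedTime V huv b ω).lt_or_eq with h | h
  · have h0 := hV.tendsto_leftVal (zero_le.trans_lt h) (exceedTime_le V u v b ω) ω
    have : (𝓝[<] (exceedTime V u v b ω)).NeBot := nhdsLT_neBot_of_exists_lt ⟨u, h⟩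
    refine le_of_tendsto ((h0.sub_const (V u ω)).abs) ?_
    filter_upwards [Ioo_mem_nhdsLT h] with x hx
    by_contra! hlt
    exact absurd ((exceedTime_lt_iff (exceedTime_le V u v b ω)).2 ⟨x, hx.1.le, hx.2, hlt⟩)
      (lt_irrefl _)
  · rw [← h, hu, sub_self, abs_zero]
    exact hb

end Exceed

/-! ### From geometric tails to exponential moments -/

theorem ofReal_exp_le_one_add_tsum {lam a x : ℝ} (ha : 0 < a) (hlam : 0 < lam)
    (hexp : Real.exp (lam * a) ≤ 11 / 10) :
    ENNReal.ofReal (Real.exp (lam * x)) ≤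
      1 + ∑' k : ℕ, ENNReal.ofReal ((1 / 10) * (11 / 10) ^ k) *
        (Set.Ioi ((k : ℝ) * a)).indicator 1 x := by
  set n := ⌈x / a⌉₊
  have hx : x ≤ n * a := (div_le_iff₀ ha).1 (Nat.le_ceil _)
  have h1 : Real.exp (lam * x) ≤ (11 / 10) ^ n := by
    calc Real.exp (lam * x) ≤ Real.exp (n * (lam * a)) := by
          apply Real.exp_le_exp.2
          nlinarith
      _ = Real.exp (lam * a) ^ n := Real.exp_nat_mul _ _
      _ ≤ (11 / 10) ^ n := pow_le_pow_left₀ (Real.exp_pos _).le hexp n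
  -- Since `k < ⌈x / a⌉₊` exactly when `k * a < x`, the terms of this geometric sum are those
  -- selected by the indicators.
  have h2 : ((11 : ℝ) / 10) ^ n = 1 + ∑ k ∈ Finset.range n, (1 / 10) * (11 / 10) ^ k := by
    rw [← Finset.mul_sum, geom_sum_eq (by norm_num)]
    ring
  calc ENNReal.ofReal (Real.exp (lam * x))
      ≤ ENNReal.ofReal (1 + ∑ k ∈ Finset.range n, (1 / 10) * (11 / 10) ^ k) :=
        ENNReal.ofReal_le_ofReal (h1.trans_eq h2)
    _ = 1 + ∑ k ∈ Finset.range n, ENNReal.ofReal ((1 / 10) * (11 / 10) ^ k) := by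
        rw [ENNReal.ofReal_add zero_le_one (Finset.sum_nonneg fun _ _ => by positivity),
          ENNReal.ofReal_one, ENNReal.ofReal_sum_of_nonneg fun _ _ => by positivity]
    _ ≤ _ := by
        gcongr
        refine le_trans (Finset.sum_le_sum fun k hk => ?_) (ENNReal.sum_le_tsum (Finset.range n))
        have hk' : (k : ℝ) * a < x := (lt_div_iff₀ ha).1 (Nat.lt_ceil.1 (Finset.mem_range.1 hk))
        rw [Set.indicator_of_mem (Set.mem_Ioi.2 hk'), Pi.one_apply, mul_one]

/-- The ratio is `11/20`, so the value is `1 + 2/9 = 11/9`, below `5/4`. -/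
theorem tsum_ofReal_mul_inv_two_pow_le :
    1 + ∑' k : ℕ, ENNReal.ofReal ((1 / 10) * (11 / 10) ^ k) * ENNReal.ofReal ((1 / 2) ^ k) ≤
      ENNReal.ofReal (5 / 4) := by
  have h : ∀ k : ℕ, ENNReal.ofReal ((1 / 10) * (11 / 10) ^ k) * ENNReal.ofReal ((1 / 2) ^ k) =
      ENNReal.ofReal ((1 / 10) * (11 / 20) ^ k) := by
    intro k
    rw [← ENNReal.ofReal_mul (by positivity), mul_assoc, ← mul_pow]
    norm_num
  have hs : Summable fun k : ℕ => (1 / 10 : ℝ) * (11 / 20) ^ k :=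
    (summable_geometric_of_lt_one (by norm_num) (by norm_num)).mul_left _
  simp_rw [h]
  rw [← ENNReal.ofReal_tsum_of_nonneg (fun _ => by positivity) hs, tsum_mul_left,
    tsum_geometric_of_lt_one (by norm_num) (by norm_num), ← ENNReal.ofReal_one,
    ← ENNReal.ofReal_add (by norm_num) (by norm_num)]
  exact ENNReal.ofReal_le_ofReal (by norm_num)

theorem setLIntegral_exp_le_of_measure_le {Ω : Type*} {mΩ : MeasurableSpace Ω} {P : Measure Ω}
    {X : Ω → ℝ} (hX : Measurable X) {A : Set Ω} {lam a : ℝ} (ha : 0 < a)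
    (hlam : 0 < lam) (hexp : Real.exp (lam * a) ≤ 11 / 10)
    (h : ∀ k : ℕ, P (A ∩ {ω | k * a < X ω}) ≤ ENNReal.ofReal ((1 / 2) ^ k) * P A) :
    ∫⁻ ω in A, ENNReal.ofReal (Real.exp (lam * X ω)) ∂P ≤ ENNReal.ofReal (5 / 4) * P A := by
  have hm : ∀ k : ℕ, MeasurableSet {ω | k * a < X ω} := fun k =>
    measurableSet_lt measurable_const hX
  have hi : ∀ (k : ℕ) ω, (Set.Ioi ((k : ℝ) * a)).indicator (1 : ℝ → ℝ≥0∞) (X ω) =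
      ({ω | k * a < X ω}).indicator 1 ω := fun k ω => rfl
  calc ∫⁻ ω in A, ENNReal.ofReal (Real.exp (lam * X ω)) ∂P
      ≤ ∫⁻ ω in A, (1 + ∑' k : ℕ, ENNReal.ofReal ((1 / 10) * (11 / 10) ^ k) *
          ({ω | k * a < X ω}).indicator 1 ω) ∂P := by
        refine lintegral_mono fun ω => ?_
        simp_rw [← hi]
        exact ofReal_exp_le_one_add_tsum ha hlam hexp
    _ = P A + ∑' k : ℕ, ENNReal.ofReal ((1 / 10) * (11 / 10) ^ k) *
          P (A ∩ {ω | k * a < X ω}) := by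
        rw [lintegral_add_left measurable_const, setLIntegral_const, one_mul, lintegral_tsum]
        · congr 2
          ext k
          rw [lintegral_const_mul _ (measurable_one.indicator (hm k)),
            lintegral_indicator_one (hm k), Measure.restrict_apply (hm k), Set.inter_comm]
        · exact fun k => ((measurable_one.indicator (hm k)).const_mul _).aemeasurable
    _ ≤ P A + ∑' k : ℕ, ENNReal.ofReal ((1 / 10) * (11 / 10) ^ k) *
          (ENNReal.ofReal ((1 / 2) ^ k) * P A) := by
        gcongr with k
        exact h k
    _ = (1 + ∑' k : ℕ, ENNReal.ofReal ((1 / 10) * (11 / 10) ^ k) *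
          ENNReal.ofReal ((1 / 2) ^ k)) * P A := by
        simp_rw [← mul_assoc]
        rw [ENNReal.tsum_mul_right, add_mul, one_mul]
    _ ≤ _ := by
        gcongr
        exact tsum_ofReal_mul_inv_two_pow_le

/-- The bound on sets is an inequality between the measures `g·P` and `C·P` on `m`, hence extends to
nonnegative `m`-measurable functions. -/
theorem lintegral_mul_le_of_setLIntegral_le {Ω : Type*} {m mΩ : MeasurableSpace Ω}
    {P : Measure Ω} (hm : m ≤ mΩ) {g : Ω → ℝ≥0∞} (hg : Measurable g) {C : ℝ≥0∞}
    (h : ∀ A, MeasurableSet[m] A → ∫⁻ ω in A, g ω ∂P ≤ C * P A)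
    {f : Ω → ℝ≥0∞} (hf : Measurable[m] f) : ∫⁻ ω, f ω * g ω ∂P ≤ C * ∫⁻ ω, f ω ∂P := by
  have hle : (P.withDensity g).trim hm ≤ C • P.trim hm := by
    refine Measure.le_iff.2 fun A hA => ?_
    rw [trim_measurableSet_eq hm hA, withDensity_apply _ (hm _ hA), Measure.smul_apply,
      trim_measurableSet_eq hm hA, smul_eq_mul]
    exact h A hA
  calc ∫⁻ ω, f ω * g ω ∂P = ∫⁻ ω, f ω ∂((P.withDensity g).trim hm) := by
        rw [lintegral_trim hm hf, lintegral_withDensity_eq_lintegral_mul _ hg (hf.mono hm le_rfl)]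
        simp_rw [Pi.mul_apply, mul_comm]
    _ ≤ ∫⁻ ω, f ω ∂(C • P.trim hm) := lintegral_mono' hle le_rfl
    _ = C * ∫⁻ ω, f ω ∂P := by
        rw [lintegral_smul_measure, lintegral_trim hm hf, smul_eq_mul]

/-! ### The John–Nirenberg estimate and its concatenation -/

section JohnNirenberg

variable {Ω : Type*} {mΩ : MeasurableSpace Ω} {P : Measure Ω} {𝓕 : Filtration ℝ≥0 mΩ}
  {V : ℝ≥0 → Ω → ℝ} {u v : ℝ≥0}

/-- At the passage times `S` of `b` and `T` of `b + a`, on the smaller event `|V_T - V_u| ≥ b + a`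
and `|V_{S-} - V_u| ≤ b`. A jump at `S` does no harm, since the increment starts from `V_{S-}`. -/
theorem IsAdaptedRCLL.mul_measure_lt_supIncrement_le [IsProbabilityMeasure P]
    [𝓕.IsRightContinuous] (hV : IsAdaptedRCLL 𝓕 v V) (huv : u ≤ v)
    (hu : ∀ᵐ ω ∂P, leftVal V u ω = V u ω) {a b : ℝ} (hb : 0 ≤ b) (ha : 0 ≤ a)
    {A : Set Ω} (hA : MeasurableSet[𝓕 u] A) :
    ENNReal.ofReal a * P (A ∩ {ω | b + a < supIncrement V u v ω}) ≤
      modulusMO P 𝓕 V u v * P (A ∩ {ω | b < supIncrement V u v ω}) := by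
  refine le_trans ?_ (setLIntegral_le_modulusMO (hV.isStoppingTime_exceedTime (u := u) b)
    (hV.isStoppingTime_exceedTime (u := u) (b + a))
    (fun ω => ⟨le_exceedTime V huv b ω, exceedTime_mono V u v (le_add_of_nonneg_right ha) ω,
      exceedTime_le V u v _ ω⟩)
    (hV.measurableSet_lt_supIncrement_inter huv b hA))
  have hsub : A ∩ {ω | b + a < supIncrement V u v ω} ⊆ A ∩ {ω | b < supIncrement V u v ω} :=
    Set.inter_subset_inter_right _ fun ω hω => (le_add_of_nonneg_right ha).trans_lt hω
  refine le_trans ?_ (lintegral_mono_set hsub)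
  rw [← setLIntegral_const]
  have hms : MeasurableSet (A ∩ {ω | b + a < supIncrement V u v ω}) :=
    (𝓕.le u _ hA).inter (𝓕.le v _ (hV.measurableSet_lt_supIncrement huv (b + a)))
  refine lintegral_mono_ae ?_
  filter_upwards [ae_restrict_mem hms, ae_restrict_of_ae hu] with ω hω huω
  refine ENNReal.ofReal_le_ofReal ?_
  have h1 := hV.le_abs_exceedTime huv hω.2
  have h2 := hV.abs_leftVal_exceedTime_le huv hb huω
  have h3 := abs_sub_abs_le_abs_sub (V (exceedTime V u v (b + a) ω) ω - V u ω)
    (leftVal V (exceedTime V u v b ω) ω - V u ω)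
  rw [sub_sub_sub_cancel_right] at h3
  linarith

theorem IsAdaptedRCLL.measure_lt_supIncrement_le [IsProbabilityMeasure P]
    [𝓕.IsRightContinuous] (hV : IsAdaptedRCLL 𝓕 v V) (huv : u ≤ v)
    (hu : ∀ᵐ ω ∂P, leftVal V u ω = V u ω) {a : ℝ} (ha : 0 < a)
    (hρ : modulusMO P 𝓕 V u v ≤ ENNReal.ofReal (a / 2))
    {A : Set Ω} (hA : MeasurableSet[𝓕 u] A) (k : ℕ) :
    P (A ∩ {ω | k * a < supIncrement V u v ω}) ≤ ENNReal.ofReal ((1 / 2) ^ k) * P A := by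
  induction k with
  | zero =>
    rw [pow_zero, ENNReal.ofReal_one, one_mul]
    exact measure_mono Set.inter_subset_left
  | succ k ih =>
    have h := hV.mul_measure_lt_supIncrement_le huv hu (b := k * a) (by positivity) ha.le hA
    have hcast : ((k + 1 : ℕ) : ℝ) * a = k * a + a := by push_cast; ring
    rw [hcast]
    have h2 : ENNReal.ofReal a * P (A ∩ {ω | k * a + a < supIncrement V u v ω}) ≤
        ENNReal.ofReal a * (ENNReal.ofReal ((1 / 2) ^ (k + 1)) * P A) := by
      calc _ ≤ _ := h
        _ ≤ ENNReal.ofReal (a / 2) * (ENNReal.ofReal ((1 / 2) ^ k) * P A) := by gcongr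
        _ = _ := by
          rw [← mul_assoc, ← mul_assoc, ← ENNReal.ofReal_mul (by positivity),
            ← ENNReal.ofReal_mul (by positivity)]
          congr 2
          ring
    rwa [ENNReal.mul_le_mul_iff_right (by simpa using ha) ENNReal.ofReal_ne_top] at h2

/-- `E_s exp(λ sup_{[s,t]} |V - V_s|) ≤ C`, tested against nonnegative `𝓕_s`-measurable
functions. -/
def ExpMomentLE (P : Measure Ω) (𝓕 : Filtration ℝ≥0 mΩ) (V : ℝ≥0 → Ω → ℝ) (lam : ℝ)
    (s t : ℝ≥0) (C : ℝ≥0∞) : Prop :=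
  ∀ f : Ω → ℝ≥0∞, Measurable[𝓕 s] f →
    ∫⁻ ω, f ω * ENNReal.ofReal (Real.exp (lam * supIncrement V s t ω)) ∂P ≤ C * ∫⁻ ω, f ω ∂P

theorem ExpMomentLE.mono {lam : ℝ} {C C' : ℝ≥0∞} (h : ExpMomentLE P 𝓕 V lam u v C)
    (hC : C ≤ C') : ExpMomentLE P 𝓕 V lam u v C' :=
  fun f hf => (h f hf).trans (by gcongr)

theorem IsAdaptedRCLL.measurable_exp_supIncrement (hV : IsAdaptedRCLL 𝓕 v V) (huv : u ≤ v)
    (lam : ℝ) :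
    Measurable[𝓕 v] fun ω => ENNReal.ofReal (Real.exp (lam * supIncrement V u v ω)) :=
  (Real.measurable_exp.comp ((hV.measurable_supIncrement huv).const_mul lam)).ennreal_ofReal

theorem IsAdaptedRCLL.expMomentLE [IsProbabilityMeasure P]
    [𝓕.IsRightContinuous] (hV : IsAdaptedRCLL 𝓕 v V) (huv : u ≤ v)
    (hu : ∀ᵐ ω ∂P, leftVal V u ω = V u ω) {lam : ℝ} (hlam : 0 < lam)
    (hρ : modulusMO P 𝓕 V u v ≤ ENNReal.ofReal (22 * lam)⁻¹) :
    ExpMomentLE P 𝓕 V lam u v (ENNReal.ofReal (5 / 4)) := by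
  intro f hf
  refine lintegral_mul_le_of_setLIntegral_le (𝓕.le u)
    ((hV.measurable_exp_supIncrement huv lam).mono (𝓕.le v) le_rfl) (fun A hA => ?_) hf
  -- This level spacing gives `a / 2 = 1/(22λ)`, and `e^{1/11} ≤ 1/(1 - 1/11) = 11/10`.
  have ha : 0 < (11 * lam)⁻¹ := by positivity
  refine setLIntegral_exp_le_of_measure_le ((hV.measurable_supIncrement huv).mono (𝓕.le v) le_rfl)
    ha hlam ?_ (hV.measure_lt_supIncrement_le huv hu ha (hρ.trans_eq ?_) hA)
  · have h1 : lam * (11 * lam)⁻¹ = 1 / 11 := by field_simp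
    rw [h1]
    have h2 := Real.exp_bound_div_one_sub_of_interval (x := 1 / 11) (by norm_num) (by norm_num)
    exact h2.trans (by norm_num)
  · congr 1
    field_simp
    norm_num

theorem supIncrement_le_add {w : ℝ≥0} (hV : IsAdaptedRCLL 𝓕 w V) (huv : u ≤ v) (hvw : v ≤ w)
    (ω : Ω) : supIncrement V u w ω ≤ supIncrement V u v ω + supIncrement V v w ω := by
  have : Nonempty (Set.Icc u w) := ⟨⟨u, le_rfl, huv.trans hvw⟩⟩
  have h1 : ∀ x, u ≤ x → x ≤ v → |V x ω - V u ω| ≤ supIncrement V u v ω := fun x hx hx' =>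
    le_ciSup ((hV.mono hvw).bddAbove u ω) ⟨x, hx, hx'⟩
  have h2 : ∀ x, v ≤ x → x ≤ w → |V x ω - V v ω| ≤ supIncrement V v w ω := fun x hx hx' =>
    le_ciSup (hV.bddAbove v ω) ⟨x, hx, hx'⟩
  refine ciSup_le fun ⟨x, hux, hxw⟩ => ?_
  rcases le_total x v with hx | hx
  · exact (h1 x hux hx).trans (le_add_of_nonneg_right (supIncrement_nonneg V v w ω))
  · calc |V x ω - V u ω| ≤ |V x ω - V v ω| + |V v ω - V u ω| := abs_sub_le _ _ _
      _ ≤ _ := by linarith [h1 v huv le_rfl, h2 x hx hxw]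

/-- The test function times the exponential on `[u,v]` is `𝓕 v`-measurable, hence a test function
for `[v,w]`; this is why functions rather than sets are tested. -/
theorem ExpMomentLE.trans {w : ℝ≥0} (hV : IsAdaptedRCLL 𝓕 w V) (huv : u ≤ v) (hvw : v ≤ w)
    {lam : ℝ} (hlam : 0 < lam) {C C' : ℝ≥0∞} (h : ExpMomentLE P 𝓕 V lam u v C)
    (h' : ExpMomentLE P 𝓕 V lam v w C') : ExpMomentLE P 𝓕 V lam u w (C' * C) := by
  intro f hf
  have hm := (hV.mono hvw).measurable_exp_supIncrement huv lam
  calc ∫⁻ ω, f ω * ENNReal.ofReal (Real.exp (lam * supIncrement V u w ω)) ∂P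
      ≤ ∫⁻ ω, (f ω * ENNReal.ofReal (Real.exp (lam * supIncrement V u v ω))) *
          ENNReal.ofReal (Real.exp (lam * supIncrement V v w ω)) ∂P := by
        refine lintegral_mono fun ω => ?_
        rw [mul_assoc, ← ENNReal.ofReal_mul (Real.exp_pos _).le, ← Real.exp_add, ← mul_add]
        gcongr
        exact supIncrement_le_add hV huv hvw ω
    _ ≤ C' * ∫⁻ ω, f ω * ENNReal.ofReal (Real.exp (lam * supIncrement V u v ω)) ∂P :=
        h' _ ((hf.mono (𝓕.mono huv) le_rfl).mul hm)
    _ ≤ C' * (C * ∫⁻ ω, f ω ∂P) := by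
        gcongr
        exact h f hf
    _ = _ := (mul_assoc _ _ _).symm

theorem ExpMomentLE.condExpMoment_le [IsProbabilityMeasure P] {lam : ℝ} {C : ℝ≥0∞}
    (h : ExpMomentLE P 𝓕 V lam u v C) : ∀ᵐ ω ∂P, condExpMoment P 𝓕 V v u lam ω ≤ C := by
  refine ae_le_of_ae_le_trim (hm := 𝓕.le u) ?_
  refine ae_le_of_forall_setLIntegral_le_of_sigmaFinite (μ := P.trim (𝓕.le u))
    (measurable_condLExp _ _ _) fun A hA _ => ?_
  rw [condExpMoment, setLIntegral_condLExp_trim (𝓕.le u) _ _ hA, setLIntegral_const,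
    trim_measurableSet_eq _ hA]
  have hf : Measurable[𝓕 u] (A.indicator (1 : Ω → ℝ≥0∞)) := by
    let := 𝓕 u
    exact measurable_one.indicator hA
  have h1 := h _ hf
  rw [lintegral_indicator_one (𝓕.le u _ hA)] at h1
  rw [← lintegral_indicator (𝓕.le u _ hA)]
  refine le_trans (lintegral_mono fun ω => ?_) h1
  by_cases hω : ω ∈ A <;> simp [hω]

end JohnNirenberg

/-! ### Greedy partition and the p-variation count -/

section Partition

variable {Ω : Type*} {mΩ : MeasurableSpace Ω} {P : Measure Ω} {𝓕 : Filtration ℝ≥0 mΩ}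
  {V : ℝ≥0 → Ω → ℝ} {p : ℝ} {s t : ℝ≥0} {y : ℝ≥0∞}

/-- Some partition of `[s,t]` has `∑ ρ^p ≥ y`. -/
def ExistsPartitionSumGE (P : Measure Ω) (𝓕 : Filtration ℝ≥0 mΩ) (V : ℝ≥0 → Ω → ℝ) (p : ℝ)
    (s t : ℝ≥0) (y : ℝ≥0∞) : Prop :=
  ∃ (n : ℕ) (x : ℕ → ℝ≥0), (StrictMonoOn x (Set.Iic n) ∧ x 0 = s ∧ x n = t) ∧
    y ≤ ∑ i ∈ Finset.range n, modulusMO P 𝓕 V (x i) (x (i + 1)) ^ p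

theorem ExistsPartitionSumGE.refl (t : ℝ≥0) : ExistsPartitionSumGE P 𝓕 V p t t 0 := by
  refine ⟨0, fun _ => t, ⟨fun i hi j hj hij => ?_, rfl, rfl⟩, zero_le⟩
  simp only [Set.mem_Iic] at hi hj
  omega

theorem ExistsPartitionSumGE.cons {m : ℝ≥0} (hsm : s < m)
    (h : ExistsPartitionSumGE P 𝓕 V p m t y) :
    ExistsPartitionSumGE P 𝓕 V p s t (modulusMO P 𝓕 V s m ^ p + y) := by
  obtain ⟨n, x, ⟨hx, h0, hn⟩, hy⟩ := h
  refine ⟨n + 1, fun k => Nat.casesOn k s x, ⟨?_, rfl, hn⟩, ?_⟩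
  · intro i hi j hj hij
    simp only [Set.mem_Iic] at hi hj
    obtain _ | j := j
    · omega
    have hj' : j ≤ n := by omega
    obtain _ | i := i
    · refine hsm.trans_le ?_
      rw [← h0]
      exact hx.monotoneOn (Set.mem_Iic.2 (Nat.zero_le n)) (Set.mem_Iic.2 hj') (Nat.zero_le j)
    · exact hx (Set.mem_Iic.2 (by omega)) (Set.mem_Iic.2 hj') (by omega)
  · rw [Finset.sum_range_succ', add_comm]
    refine add_le_add hy ?_
    simp [h0]

theorem ExistsPartitionSumGE.mono {y' : ℝ≥0∞} (h : ExistsPartitionSumGE P 𝓕 V p s t y)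
    (hy : y' ≤ y) : ExistsPartitionSumGE P 𝓕 V p s t y' := by
  obtain ⟨n, x, hx, hxy⟩ := h
  exact ⟨n, x, hx, hy.trans hxy⟩

theorem ExistsPartitionSumGE.of_le (hst : s ≤ t) : ExistsPartitionSumGE P 𝓕 V p s t 0 := by
  rcases hst.eq_or_lt with rfl | h
  · exact .refl s
  · exact ((ExistsPartitionSumGE.refl t).cons h).mono zero_le

theorem ExistsPartitionSumGE.le_controlMO (h : ExistsPartitionSumGE P 𝓕 V p s t y)
    (hp : p ≠ 0) : y ≤ controlMO P 𝓕 V p s t := by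
  obtain ⟨n, x, hx, hxy⟩ := h
  rw [controlMO, pVarMO, ← ENNReal.rpow_mul, one_div_mul_cancel hp, ENNReal.rpow_one]
  exact hxy.trans (le_iSup_of_le n (le_iSup_of_le x (le_iSup_of_le hx le_rfl)))

/-- Here `[s,t]` is the open cell, `j` bounds the remaining steps of length `h`, and `N` counts the
cells still to be closed. -/
theorem IsVMO.exists_expMomentLE_of_le_add_mul [IsProbabilityMeasure P] [𝓕.IsRightContinuous]
    {τ : ℝ≥0} (hV : IsVMO P 𝓕 τ V) {lam : ℝ} (hlam : 0 < lam) (hp : 0 ≤ p) {h : ℝ≥0}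
    (hh : ∀ u v, u ≤ v → v ≤ τ → v ≤ u + h →
      modulusMO P 𝓕 V u v ≤ ENNReal.ofReal (22 * lam)⁻¹) (j : ℕ) :
    ∀ s t, s ≤ t → t ≤ τ → τ ≤ t + j * h →
      modulusMO P 𝓕 V s t ≤ ENNReal.ofReal (22 * lam)⁻¹ →
      ∃ N : ℕ, ExpMomentLE P 𝓕 V lam s τ (2 ^ (N + 1)) ∧
        ExistsPartitionSumGE P 𝓕 V p s τ (N * ENNReal.ofReal (22 * lam)⁻¹ ^ p) := by
  have key : ∀ u v, u ≤ v → v ≤ τ → modulusMO P 𝓕 V u v ≤ ENNReal.ofReal (22 * lam)⁻¹ →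
      ExpMomentLE P 𝓕 V lam u v (ENNReal.ofReal (5 / 4)) := fun u v huv hv hρ =>
    (hV.bmo.rcll.mono hv).expMomentLE huv (hV.leftVal_ae_eq (huv.trans hv)) hlam hρ
  induction j with
  | zero =>
    intro s t hst htτ hτ hρ
    obtain rfl : t = τ := le_antisymm htτ (by simpa using hτ)
    refine ⟨0, (key s t hst le_rfl hρ).mono ?_, ?_⟩
    · rw [zero_add, pow_one]
      exact ENNReal.ofReal_le_of_le_toReal (by norm_num)
    · rw [Nat.cast_zero, zero_mul]
      exact .of_le hst
  | succ j ih =>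
    intro s t hst htτ hτ hρ
    set t' := min (t + h) τ with ht'
    have htt' : t ≤ t' := le_min le_self_add htτ
    have ht'τ : t' ≤ τ := min_le_right _ _
    have hτ' : τ ≤ t' + j * h := by
      rcases min_choice (t + h) τ with hm | hm <;> rw [ht', hm]
      · refine hτ.trans_eq ?_
        push_cast
        ring
      · exact le_self_add
    -- Either the cell is extended to `t'`, or it is closed there and a new, degenerate cell starts
    -- at `t'`.
    by_cases hρ' : modulusMO P 𝓕 V s t' ≤ ENNReal.ofReal (22 * lam)⁻¹
    · exact ih s t' (hst.trans htt') ht'τ hτ' hρ'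
    · have hself : modulusMO P 𝓕 V t' t' ≤ ENNReal.ofReal (22 * lam)⁻¹ :=
        hh t' t' le_rfl ht'τ le_self_add
      obtain ⟨N, hN, hpart⟩ := ih t' t' le_rfl ht'τ hτ' hself
      have hlt : s < t' := by
        refine lt_of_le_of_ne (hst.trans htt') fun heq => hρ' ?_
        rw [heq]
        exact hself
      have h1 := key s t hst htτ hρ
      have h2 := key t t' htt' ht'τ (hh t t' htt' ht'τ (min_le_left _ _))
      have h3 := h1.trans (hV.bmo.rcll.mono ht'τ) hst htt' hlam h2
      refine ⟨N + 1, (h3.trans hV.bmo.rcll hlt.le ht'τ hlam hN).mono ?_, (hpart.cons hlt).mono ?_⟩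
      -- The closed cell contributes `(5/4)² = 25/16 ≤ 2`.
      · rw [pow_succ 2 (N + 1), ← ENNReal.ofReal_mul (by norm_num)]
        gcongr
        exact ENNReal.ofReal_le_of_le_toReal (by norm_num)
      · rw [Nat.cast_add, Nat.cast_one, add_comm, add_mul, one_mul]
        gcongr
        exact (not_le.1 hρ').le

theorem IsVMO.exists_expMomentLE [IsProbabilityMeasure P] [𝓕.IsRightContinuous]
    {τ : ℝ≥0} (hV : IsVMO P 𝓕 τ V) {lam : ℝ} (hlam : 0 < lam) (hp : 0 < p) {r : ℝ≥0}
    (hr : r ≤ τ) :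
    ∃ N : ℕ, ExpMomentLE P 𝓕 V lam r τ (2 ^ (N + 1)) ∧
      N * ENNReal.ofReal (22 * lam)⁻¹ ^ p ≤ controlMO P 𝓕 V p 0 τ := by
  obtain ⟨h, h0, hh⟩ := hV.exists_modulusMO_le (c := ENNReal.ofReal (22 * lam)⁻¹)
    (ENNReal.ofReal_pos.2 (by positivity))
  obtain ⟨j, hj⟩ := exists_nat_ge (τ / h)
  obtain ⟨N, hN, hpart⟩ := hV.exists_expMomentLE_of_le_add_mul hlam hp.le hh j r r le_rfl hr
    (((div_le_iff₀ h0).1 hj).trans le_add_self) (hh r r le_rfl hr le_self_add)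
  refine ⟨N, hN, ?_⟩
  -- The control is taken over `[0,τ]`, so for `r > 0` the cell `[0,r]` is prepended and its term
  -- dropped.
  rcases eq_or_lt_of_le (zero_le : 0 ≤ r) with rfl | hr0
  · exact hpart.le_controlMO hp.ne'
  · exact ((hpart.cons hr0).mono le_add_self).le_controlMO hp.ne'

end Partition

theorem mainTheorem2 {Ω : Type*} [mΩ : MeasurableSpace Ω] (P : Measure Ω)
    [IsProbabilityMeasure P] (𝓕 : Filtration ℝ≥0 mΩ) (h𝓕 : UsualConditions P 𝓕)
    (τ : ℝ≥0) (hτ : 0 < τ) (V : ℝ≥0 → Ω → ℝ) (hV : IsVMO P 𝓕 τ V) :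
    (∀ r ≤ τ, ∀ lam : ℝ, 0 < lam →
      ∃ c : ℝ≥0, ∀ᵐ ω ∂P, condExpMoment P 𝓕 V τ r lam ω ≤ c) ∧
    (∀ p : ℝ, 1 ≤ p → IsVMOpVar P 𝓕 τ V p → ∀ lam : ℝ, 0 < lam → ∀ r ≤ τ,
      ∀ᵐ ω ∂P, condExpMoment P 𝓕 V τ r lam ω ≤
        ENNReal.ofReal
          ((2 : ℝ) ^ (1 + (22 * lam) ^ p * (controlMO P 𝓕 V p 0 τ).toReal))) := by
  have := h𝓕.rightContinuous
  refine ⟨fun r hr lam hlam => ?_, fun p hp hVp lam hlam r hr => ?_⟩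
  -- Only the finiteness of `N` matters here, so `p = 1` is an arbitrary choice.
  · obtain ⟨N, hN, -⟩ := hV.exists_expMomentLE hlam (p := 1) one_pos hr
    refine ⟨2 ^ (N + 1), ?_⟩
    filter_upwards [hN.condExpMoment_le] with ω hω
    exact_mod_cast hω
  · have hp0 : 0 < p := zero_lt_one.trans_le hp
    obtain ⟨N, hN, hc⟩ := hV.exists_expMomentLE hlam hp0 hr
    have hfin : controlMO P 𝓕 V p 0 τ ≠ ∞ := ENNReal.rpow_ne_top_of_nonneg hp0.le hVp.finite.ne
    have h1 := ENNReal.toReal_mono hfin hc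
    rw [ENNReal.toReal_mul, ENNReal.toReal_natCast, ← ENNReal.toReal_rpow,
      ENNReal.toReal_ofReal (by positivity), Real.inv_rpow (by positivity),
      ← div_eq_mul_inv, div_le_iff₀ (by positivity), mul_comm] at h1
    filter_upwards [hN.condExpMoment_le] with ω hω
    refine hω.trans ?_
    calc (2 : ℝ≥0∞) ^ (N + 1) = ENNReal.ofReal ((2 : ℝ) ^ ((N + 1 : ℕ) : ℝ)) := by
          rw [Real.rpow_natCast, ENNReal.ofReal_pow (by norm_num)]
          simp
      _ ≤ _ := by
          refine ENNReal.ofReal_le_ofReal (Real.rpow_le_rpow_of_exponent_le one_le_two ?_)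
          push_cast
          linarith
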